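/- Let $(R,\mathfrak m)$ be a Noetherian local ring of prime characteristic $p>0$. For an ideal $I\subseteq R$ and $e\ge 0$ let $I^{[p^e]}=(y^{p^e}\mid y\in I)$ be its Frobenius power, and let $I^F=\{x\in R \mid x^{p^e}\in I^{[p^e]}\text{ for all } e\gg 0\}$ be its Frobenius closure. A parameter of a local ring $(A,\mathfrak n)$ is an element $x\in\mathfrak n$ with $\dim A/(x)=\dim A-1$; a parameter ideal of $R$ is an ideal $\mathfrak q=(x_1,\ldots,x_t)$, $0\le t\le \dim R$, such that the image of $x_{i+1}$ is a parameter in $R/(x_1,\ldots,x_i)$ for all $0\le i<t$ (for $t=0$ this is $\mathfrak q=(0)$). If every parameter ideal $\mathfrak q$ of $R$ satisfies $(\mathfrak q^F)^{[p]}=(\mathfrak q^{[p]})^F$, then $R$ is F-injective, i.e. for every $i\ge 0$ the map $H^i_{\mathfrak m}(R)\to H^i_{\mathfrak m}(F_*R)\cong F_*H^i_{\mathfrak m}(R)$ induced by the Frobenius map $F\colon R\to F_*R$, $x\mapsto x^p$ (that is, the Frobenius action on $H^i_{\mathfrak m}(R)$), is injective. Here $F_*R$ denotes $R$ regarded as an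 $R$-module through $F$. -/

import Mathlib

universe u

section FrobeniusPowers

variable {R : Type u} [CommRing R]

/-- The Frobenius power `I^[p^e] = (y^(p^e) | y ∈ I)` of an ideal `I`. -/
def frobeniusPower (p e : ℕ) (I : Ideal R) : Ideal R :=
  Ideal.span ((fun y : R => y ^ p ^ e) '' (I : Set R))

/-- The Frobenius closure `I^F` of an ideal `I` in a ring of characteristic `p`: the ideal of all
`x` such that `x^(p^e) ∈ I^[p^e]` for all sufficiently large `e`. -/
def frobeniusClosure (p : ℕ) [Fact p.Prime] [CharP R p] (I : Ideal R) : Ideal R where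
  carrier := {x | ∀ᶠ e : ℕ in Filter.atTop, x ^ p ^ e ∈ frobeniusPower p e I}
  add_mem' := by
    intro a b ha hb
    filter_upwards [ha, hb] with e hae hbe
    rw [add_pow_char_pow]
    exact Ideal.add_mem _ hae hbe
  zero_mem' := by
    refine Filter.Eventually.of_forall fun e => ?_
    rw [zero_pow (pow_ne_zero e (Fact.out : p.Prime).ne_zero)]
    exact Ideal.zero_mem _
  smul_mem' := by
    intro c x hx
    filter_upwards [hx] with e he
    rw [smul_eq_mul, mul_pow]
    exact Ideal.mul_mem_left _ _ he

end FrobeniusPowers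

section Parameters

/-- An element `x` of a local ring `A` is a parameter if it lies in the maximal ideal
(that is, `x` is not a unit) and `dim A/(x) = dim A - 1`. -/
def IsParameter {A : Type u} [CommRing A] (x : A) : Prop :=
  x ∈ nonunits A ∧ ringKrullDim (A ⧸ Ideal.span {x}) + 1 = ringKrullDim A

variable {R : Type u} [CommRing R]

/-- `x_0, …, x_{t-1}` is a (possibly partial) system of parameters of the local ring `R`
if the image of `x_i` is a parameter in `R/(x_0, …, x_{i-1})` for every `i < t`. -/
def IsSystemOfParameters {t : ℕ} (x : Fin t → R) : Prop :=
  ∀ i : Fin t,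
    IsParameter (Ideal.Quotient.mk (Ideal.span (x '' {j | j < i})) (x i))

/-- A parameter ideal: an ideal generated by a system of parameters `x_0, …, x_{t-1}`.
The case `t = 0` is the zero ideal. -/
def IsParameterIdeal (q : Ideal R) : Prop :=
  ∃ (t : ℕ) (x : Fin t → R), IsSystemOfParameters x ∧ q = Ideal.span (Set.range x)

end Parameters

section FInjectivity

open CategoryTheory

variable (R : Type u) [CommRing R] (p : ℕ) [Fact p.Prime] [CharP R p]

/-- The Frobenius map of `R`, as a homomorphism of `R`-modules `R ⟶ F_* R`, where `F_* R` is the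
abelian group `R` on which `r` acts as multiplication by `r^p`. -/
noncomputable def frobeniusToPushforward :
    ModuleCat.of R R ⟶
      (ModuleCat.restrictScalars (frobenius R p)).obj (ModuleCat.of R R) :=
  ModuleCat.ofHom
    (Y := (ModuleCat.restrictScalars (frobenius R p)).obj (ModuleCat.of R R))
    { toFun := fun x => (x ^ p : R)
      map_add' := fun x y => add_pow_char x y p
      map_smul' := fun r x => mul_pow r x p }

/-- A local ring `R` of characteristic `p` with maximal ideal `m` is F-injective if, for all `i`,
the map `H^i_m(R) ⟶ H^i_m(F_* R)` induced by the Frobenius map of `R` is injective. The target is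
canonically `F_* H^i_m(R)` (local cohomology does not change under restriction of scalars, and
`m` and `F(m)R` have the same radical), and under this identification the map is the Frobenius
action on `H^i_m(R)`. -/
def IsFInjective [IsLocalRing R] : Prop :=
  ∀ i : ℕ, Function.Injective
    ((localCohomology (IsLocalRing.maximalIdeal R) i).map (frobeniusToPushforward R p))

end FInjectivity

-- Choose a sequence x₁, …, x_i in the maximal ideal m that is m-filter regular on R: each element
-- is a nonzerodivisor modulo the previous ones up to m-torsion. In this situation injectivity on
-- H^i_m can be tested on the direct limit of the quotients M/(x₁^n, …, x_i^n)M, with multiplication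
-- by powers of x₁⋯x_i as transition maps. This is proved by induction on i. The kernel of M → M_x
-- is m-torsion, so it has no cohomology in positive degrees, and M_x has none at all. Hence
-- injectivity in degree i on the cokernel C of M → M_x gives injectivity in degree i + 1 on M
-- (`cohInj_succ`). The rest of the sequence stays filter regular on C, and the limit for C is the
-- limit for M (`cohInj_of_limInjective`). Everything is phrased with explicit cocycles on
-- resolutions of R/m^n.
--
-- By prime avoidance the sequence can be made of parameters until it generates an m-primary ideal;
-- from then on zeros are appended, and the limit is zero.
--
-- For parameters, put q = (x₁, …, x_i). Suppose the Frobenius kills the class of z in the limit at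
-- level n. After multiplying by a power of x₁⋯x_i, one may take n = p^e with e large, and then z ∈
-- (q^[p^e])^F. Iterating the hypothesis along the parameter ideals q^[p^e] gives (q^[p^e])^F =
-- (q^F)^[p^e], and for large e this lies in q^[p^e] because q^F is finitely generated. So z is zero
-- in the limit.

universe v w

/-! ### Cocycles and their classes in the opposite of a module category -/

section Represents

open CategoryTheory Opposite Limits

variable {R : Type u} [CommRing R] {ι : Type w} {c : ComplexShape ι}

/-- For a complex in the opposite of the category of modules, the relation "`φ` is a cocycle
with class `η`" between elements of the terms and elements of the homology. -/
def Represents (K : HomologicalComplex (ModuleCat.{v} R)ᵒᵖ c) (i : ι)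
    (φ : (K.X i).unop) (η : (K.homology i).unop) : Prop :=
  ∃ z : (K.opcycles i).unop,
    (K.pOpcycles i).unop.hom z = φ ∧ (K.homologyι i).unop.hom z = η

variable {K L : HomologicalComplex (ModuleCat.{v} R)ᵒᵖ c} {i j : ι}

lemma exists_represents (η : (K.homology i).unop) : ∃ φ, Represents K i φ η := by
  have : Function.Surjective (K.homologyι i).unop.hom :=
    (ModuleCat.epi_iff_surjective _).1 inferInstance
  obtain ⟨z, hz⟩ := this η
  exact ⟨_, z, rfl, hz⟩

lemma Represents.d_eq_zero {φ : (K.X i).unop} {η} (h : Represents K i φ η) (j : ι) :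
    (K.d j i).unop.hom φ = 0 := by
  obtain ⟨z, rfl, -⟩ := h
  have : (K.pOpcycles i).unop ≫ (K.d j i).unop = 0 := by
    rw [← unop_comp, K.d_pOpcycles]; rfl
  simpa using congr($(this).hom z)

/-- After `unop`, opcycles become cocycles and `homologyι` becomes the quotient map onto cohomology,
whose kernel is the image of the differential. -/
lemma represents_zero_iff (hj : c.next i = j) {φ : (K.X i).unop} :
    Represents K i φ 0 ↔ ∃ ψ, φ = (K.d i j).unop.hom ψ := by
  have hd : (K.fromOpcycles i j).unop ≫ (K.pOpcycles i).unop = (K.d i j).unop := by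
    rw [← unop_comp, K.p_fromOpcycles]
  constructor
  · rintro ⟨z, rfl, hz⟩
    have ex : (ShortComplex.mk (K.homologyι i) (K.fromOpcycles i j) (by simp)).Exact :=
      ShortComplex.exact_of_f_is_kernel _ (K.homologyIsKernel i j hj)
    have := (ShortComplex.moduleCat_exact_iff _).1 ex.unop z hz
    obtain ⟨ψ, rfl⟩ := this
    exact ⟨ψ, congr($(hd).hom ψ)⟩
  · rintro ⟨ψ, rfl⟩
    refine ⟨(K.fromOpcycles i j).unop.hom ψ, congr($(hd).hom ψ), ?_⟩
    have : (K.fromOpcycles i j).unop ≫ (K.homologyι i).unop = 0 := by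
      rw [← unop_comp, K.homologyι_comp_fromOpcycles]; rfl
    simpa using congr($(this).hom ψ)

lemma Represents.map {φ : (L.X i).unop} {η} (h : Represents L i φ η) (f : K ⟶ L) :
    Represents K i ((f.f i).unop.hom φ) ((HomologicalComplex.homologyMap f i).unop.hom η) := by
  obtain ⟨z, rfl, rfl⟩ := h
  refine ⟨(HomologicalComplex.opcyclesMap f i).unop.hom z, ?_, ?_⟩
  · have := congr($(HomologicalComplex.p_opcyclesMap f i).unop.hom z)
    exact this
  · have := congr($(HomologicalComplex.homologyι_naturality f i).unop.hom z)
    exact this.symm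

lemma Represents.eq_zero {φ : (K.X i).unop} {η} (h : Represents K i φ η)
    (h0 : Represents K i φ 0) : η = 0 := by
  obtain ⟨z, rfl, rfl⟩ := h
  obtain ⟨z', hz, hz'⟩ := h0
  have : Function.Injective (K.pOpcycles i).unop.hom :=
    (ModuleCat.mono_iff_injective _).1 inferInstance
  rw [← this hz, hz']

end Represents

/-! ### Ext classes as cocycles on a projective resolution -/

section ExtElements

open CategoryTheory Opposite Limits

variable {R : Type u} [CommRing R] {X Y : ModuleCat.{u} R} (P : ProjectiveResolution X)
  (Q : ProjectiveResolution Y) (M N : ModuleCat.{u} R) (i : ℕ)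

/-- The complex `Hom(P, M)`, in the opposite category. -/
noncomputable abbrev homComplexOp : ChainComplex (ModuleCat.{u} R)ᵒᵖ ℕ :=
  (((linearYoneda R (ModuleCat.{u} R)).obj M).rightOp.mapHomologicalComplex _).obj P.complex

/-- The identification of `Ext^i(X, M)` with the cohomology of `Hom(P, M)`. -/
noncomputable def extIso : ((Ext R (ModuleCat.{u} R) i).obj (op X)).obj M ≅
    ((homComplexOp P M).homology i).unop :=
  (P.isoLeftDerivedObj ((linearYoneda R (ModuleCat.{u} R)).obj M).rightOp i).symm.unop

/-- `φ` is a cocycle of `Hom(P, M)` with class `η` in `Ext^i(X, M)`. -/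
def RepresentsExt (φ : P.complex.X i ⟶ M)
    (η : ((Ext R (ModuleCat.{u} R) i).obj (op X)).obj M) : Prop :=
  Represents (homComplexOp P M) i φ ((extIso P M i).hom.hom η)

variable {P Q M N i}

lemma exists_representsExt (η : ((Ext R (ModuleCat.{u} R) i).obj (op X)).obj M) :
    ∃ φ, RepresentsExt P M i φ η :=
  exists_represents (K := homComplexOp P M) ((extIso P M i).hom.hom η)

lemma RepresentsExt.d_comp {φ η} (h : RepresentsExt P M i φ η) (j : ℕ) :
    P.complex.d j i ≫ φ = 0 :=
  Represents.d_eq_zero h j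

lemma representsExt_zero_iff {φ} :
    RepresentsExt P M i φ 0 ↔ ∃ ψ : P.complex.X (i - 1) ⟶ M, φ = P.complex.d i (i - 1) ≫ ψ := by
  have := represents_zero_iff (K := homComplexOp P M) (i := i) (j := i - 1) (φ := φ)
    -- In degree 0, truncated subtraction gives `i - 1 = 0`, which is also the value of `next`; the
    -- differential `d 0 0` is zero.
    (by cases i <;> simp)
  rw [← map_zero (extIso P M i).hom.hom] at this
  exact this

lemma RepresentsExt.eq_zero {φ η} (h : RepresentsExt P M i φ η)
    (h0 : RepresentsExt P M i φ 0) : η = 0 := by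
  have h0' : Represents (homComplexOp P M) i φ ((extIso P M i).hom.hom 0) := h0
  rw [map_zero] at h0'
  have h1 : (extIso P M i).hom.hom η = 0 := Represents.eq_zero h h0'
  have h3 : (extIso P M i).inv.hom ((extIso P M i).hom.hom η) = η :=
    congr($((extIso P M i).hom_inv_id).hom η)
  rw [← h3, h1, map_zero]

lemma RepresentsExt.map {φ η} (h : RepresentsExt P M i φ η) (f : M ⟶ N) :
    RepresentsExt P N i (φ ≫ f) ((((Ext R (ModuleCat.{u} R) i).obj (op X)).map f).hom η) := by
  have h1 := Represents.map h ((NatTrans.mapHomologicalComplex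
    (NatTrans.rightOp ((linearYoneda R (ModuleCat.{u} R)).map f)) _).app P.complex)
  have h2 := P.leftDerived_app_eq (NatTrans.rightOp ((linearYoneda R (ModuleCat.{u} R)).map f)) i
  rw [← Iso.inv_comp_eq] at h2
  have h3 := congr($(congrArg Quiver.Hom.unop h2).hom η)
  refine Eq.mpr ?_ h1
  exact congrArg (Represents (homComplexOp P N) i _) h3

/-- Any chain map lifting `f` computes its action on Ext, so transition maps can be arbitrary lifts
and can be composed freely. -/
lemma RepresentsExt.map_left {φ η} (h : RepresentsExt P M i φ η) (f : Y ⟶ X)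
    (g : Q.complex ⟶ P.complex) (hg : g.f 0 ≫ P.π.f 0 = Q.π.f 0 ≫ f) :
    RepresentsExt Q M i (g.f i ≫ φ)
      ((((Ext R (ModuleCat.{u} R) i).map f.op).app M).hom η) := by
  have h1 := Represents.map h
    ((((linearYoneda R (ModuleCat.{u} R)).obj M).rightOp.mapHomologicalComplex _).map g)
  have h2 := ProjectiveResolution.isoLeftDerivedObj_inv_naturality f Q P g hg
    ((linearYoneda R (ModuleCat.{u} R)).obj M).rightOp i
  have h3 := congr($(congrArg Quiver.Hom.unop h2).hom η)
  refine Eq.mpr ?_ h1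
  exact congrArg (Represents (homComplexOp Q M) i _) h3

end ExtElements

/-! ### Local cohomology as a colimit of Ext, on cocycles -/

section LocalCohomologyElements

open CategoryTheory Opposite Limits

variable {R : Type u} [CommRing R] (J : Ideal R)

/-- A projective resolution of `R/J^n`. -/
noncomputable abbrev powRes (n : ℕ) : ProjectiveResolution (ModuleCat.of R (R ⧸ J ^ n)) :=
  projectiveResolution _

/-- The projection `R/J^n' → R/J^n`. -/
noncomputable def powProj {n n' : ℕ} (h : n ≤ n') :
    ModuleCat.of R (R ⧸ J ^ n') ⟶ ModuleCat.of R (R ⧸ J ^ n) :=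
  ModuleCat.ofHom (Submodule.mapQ _ _ LinearMap.id (Ideal.pow_le_pow_right h))

/-- The augmentation of the chosen resolution of `R/J^n`. -/
noncomputable def powAug (n : ℕ) : (powRes J n).complex.X 0 ⟶ ModuleCat.of R (R ⧸ J ^ n) :=
  (powRes J n).π.f 0

/-- A chain map between the chosen resolutions is a transition map if it lifts the projection
`R/J^n' → R/J^n`. -/
def IsTransition {n n' : ℕ} (σ : (powRes J n').complex ⟶ (powRes J n).complex) : Prop :=
  ∃ h : n ≤ n', σ.f 0 ≫ powAug J n = powAug J n' ≫ powProj J h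

/-- `φ` is a coboundary of `Hom(P, M)`. In degree zero this means `φ = 0`. -/
def IsCob {J : Ideal R} {n i : ℕ} {M : ModuleCat.{u} R} (φ : (powRes J n).complex.X i ⟶ M) : Prop :=
  ∃ ψ : (powRes J n).complex.X (i - 1) ⟶ M, φ = (powRes J n).complex.d i (i - 1) ≫ ψ

/-- Every cocycle of degree `i` with values in `M` whose image under `f` eventually becomes a
coboundary eventually becomes a coboundary itself. -/
def CohInj (i : ℕ) {M N : ModuleCat.{u} R} (f : M ⟶ N) : Prop :=
  ∀ (n : ℕ) (φ : (powRes J n).complex.X i ⟶ M), (powRes J n).complex.d (i + 1) i ≫ φ = 0 →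
    (∃ (n' : ℕ) (σ : (powRes J n').complex ⟶ (powRes J n).complex),
      IsTransition J σ ∧ IsCob (σ.f i ≫ φ ≫ f)) →
    ∃ (n' : ℕ) (σ : (powRes J n').complex ⟶ (powRes J n).complex),
      IsTransition J σ ∧ IsCob (σ.f i ≫ φ)

/-- A filtered colimit of modules is computed on elements: a class comes from a cocycle at a finite
stage, and it is zero as soon as that cocycle becomes a coboundary at a later stage. -/
theorem CohInj.injective {i : ℕ} {M N : ModuleCat.{u} R} {f : M ⟶ N} (hf : CohInj J i f) :
    Function.Injective ((localCohomology J i).map f) := by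
  suffices ∀ η, ((localCohomology J i).map f).hom η = 0 → η = 0 from
    (injective_iff_map_eq_zero ((localCohomology J i).map f).hom).2 this
  intro η hη
  let D := localCohomology.diagram (localCohomology.idealPowersDiagram J) i
  have : PreservesFilteredColimitsOfSize.{0, 0} (forget (ModuleCat.{u} R)) :=
    preservesFilteredColimitsOfSize_shrink.{0, u, 0, u} _
  have hc (M : ModuleCat.{u} R) :=
    isColimitOfPreserves ((evaluation _ _).obj M) (colimit.isColimit D)
  obtain ⟨⟨⟨n⟩⟩, x, hx⟩ := Concrete.isColimit_exists_rep _ (hc M) η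
  have hx' : ((colimit.ι D (op (op n))).app M).hom x = η := hx
  have hnat := congr($((colimit.ι D (op (op n))).naturality f).hom x)
  have hη' : ((colimit.ι D (op (op n))).app N).hom (((D.obj (op (op n))).map f).hom x) = 0 := by
    refine hnat.trans ?_
    change ((localCohomology J i).map f).hom (((colimit.ι D (op (op n))).app M).hom x) = 0
    rw [hx', hη]
  obtain ⟨⟨⟨n'⟩⟩, g, g', hg⟩ := Concrete.isColimit_exists_of_rep_eq _ (hc N)
    (i := op (op n)) (j := op (op n)) (((D.obj (op (op n))).map f).hom x)
    (0 : ((D.obj (op (op n))).obj N)) (hη'.trans (map_zero _).symm)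
  have hn : n ≤ n' := g.unop.unop.down.down
  have hg' : (((Ext R (ModuleCat.{u} R) i).map (powProj J hn).op).app N).hom
      (((D.obj (op (op n))).map f).hom x) = 0 := hg.trans (map_zero ((D.map g').app N).hom)
  obtain ⟨φ, hφ⟩ := exists_representsExt (P := powRes J n) (M := M) (i := i) x
  have hlift : IsTransition J (ProjectiveResolution.lift (powProj J hn) (powRes J n')
    (powRes J n)) := ⟨hn, ProjectiveResolution.lift_commutes_zero _ _ _⟩
  have h1 := (hφ.map f).map_left (Q := powRes J n') (powProj J hn) _ hlift.2
  have h2 : RepresentsExt (powRes J n') N i _ 0 := hg' ▸ h1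
  obtain ⟨m, σ, ⟨hm, hσ⟩, hcob⟩ := hf n φ (hφ.d_comp _) ⟨n', _, hlift, representsExt_zero_iff.1 h2⟩
  have h3 := (hφ.map_left (Q := powRes J m) (powProj J hm) σ hσ).eq_zero
    (representsExt_zero_iff.2 hcob)
  have h4 : D.map (homOfLE hm).op.op ≫ colimit.ι D (op (op m)) = colimit.ι D (op (op n)) :=
    colimit.w D _
  have h5 := congr($(NatTrans.congr_app h4 M).hom x)
  refine hx'.symm.trans (h5.symm.trans ?_)
  change ((colimit.ι D (op (op m))).app M).hom ((((Ext R (ModuleCat.{u} R) i).map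
    (powProj J hm).op).app M).hom x) = 0
  rw [h3]
  exact map_zero ((colimit.ι D (op (op m))).app M).hom

end LocalCohomologyElements

/-! ### Vanishing on localizations and the degree shift -/

section Vanishing

open CategoryTheory Opposite Limits

variable {R : Type u} [CommRing R] {J : Ideal R} {n n' n'' i j : ℕ} {M N L C K : ModuleCat.{u} R}

/-- Every cocycle of degree `i` with values in `M` eventually becomes a coboundary, that is,
`H^i_J(M) = 0`. -/
def CohVanish (J : Ideal R) (i : ℕ) (M : ModuleCat.{u} R) : Prop :=
  ∀ (n : ℕ) (φ : (powRes J n).complex.X i ⟶ M), (powRes J n).complex.d (i + 1) i ≫ φ = 0 →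
    ∃ (n' : ℕ) (σ : (powRes J n').complex ⟶ (powRes J n).complex),
      IsTransition J σ ∧ IsCob (σ.f i ≫ φ)

lemma IsTransition.id : IsTransition J (𝟙 (powRes J n).complex) := by
  refine ⟨le_rfl, ?_⟩
  have : powProj J (le_refl n) = 𝟙 _ := by
    refine ModuleCat.hom_ext (LinearMap.ext fun x => ?_)
    obtain ⟨x, rfl⟩ := Ideal.Quotient.mk_surjective x
    rfl
  rw [this, HomologicalComplex.id_f, Category.id_comp, Category.comp_id]

lemma powProj_comp (h : n ≤ n') (h' : n' ≤ n'') :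
    powProj J h' ≫ powProj J h = powProj J (h.trans h') := by
  refine ModuleCat.hom_ext (LinearMap.ext fun x => ?_)
  obtain ⟨x, rfl⟩ := Ideal.Quotient.mk_surjective x
  rfl

lemma IsTransition.comp {τ : (powRes J n'').complex ⟶ (powRes J n').complex}
    {σ : (powRes J n').complex ⟶ (powRes J n).complex} (hτ : IsTransition J τ)
    (hσ : IsTransition J σ) : IsTransition J (τ ≫ σ) := by
  obtain ⟨h, hσ⟩ := hσ
  obtain ⟨h', hτ⟩ := hτ
  refine ⟨h.trans h', ?_⟩
  rw [HomologicalComplex.comp_f, Category.assoc, hσ, reassoc_of% hτ, powProj_comp]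

lemma exists_isTransition (h : n ≤ n') :
    ∃ σ : (powRes J n').complex ⟶ (powRes J n).complex, IsTransition J σ :=
  ⟨_, h, ProjectiveResolution.lift_commutes_zero (powProj J h) _ _⟩

lemma isCob_succ_iff {φ : (powRes J n).complex.X (i + 1) ⟶ M} :
    IsCob φ ↔ ∃ ψ, φ = (powRes J n).complex.d (i + 1) i ≫ ψ :=
  Iff.rfl

/-- Local cohomology in degree zero is left exact. -/
lemma cohInj_zero (f : M ⟶ N) [Mono f] : CohInj J 0 f := by
  rintro n φ hφ ⟨n', σ, hσ, ψ, hψ⟩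
  refine ⟨n', σ, hσ, 0, ?_⟩
  rw [← cancel_mono f, Category.assoc, hψ]
  simp

lemma bijective_pow_smul {L : Type*} [AddCommGroup L] [Module R L] {x : R}
    (h : Function.Bijective (fun l : L => x • l)) (n : ℕ) :
    Function.Bijective (fun l : L => x ^ n • l) := by
  have : (fun l : L => x ^ n • l) = (fun l : L => x • l)^[n] := by
    ext l; rw [smul_iterate]
  rw [this]
  exact h.iterate n

/-- Local cohomology vanishes on modules on which an element of `J` acts bijectively. -/
lemma cohVanish_of_bijective {x : R} (hx : x ∈ J)
    (h : Function.Bijective (fun m : L => x • m)) : CohVanish J i L := by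
  intro n φ hφ
  refine ⟨n, 𝟙 _, .id, ?_⟩
  let e : L ≅ L := (LinearEquiv.ofBijective (LinearMap.lsmul R L (x ^ n))
    (bijective_pow_smul h n)).toModuleIso
  have he (T : ModuleCat.{u} R) (g : T ⟶ L) : g ≫ e.hom = x ^ n • g := by
    ext; rfl
  -- Since `x ^ n` kills R/J^n, multiplication by it on the resolution lifts zero and is
  -- null-homotopic. Thus `x ^ n • φ` is a coboundary, and `x ^ n` can be divided out on `L`.
  have hzero : ((x ^ n) • 𝟙 (powRes J n).complex) ≫ (powRes J n).π = 0 := by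
    refine HomologicalComplex.to_single_hom_ext ?_
    change (x ^ n • 𝟙 ((powRes J n).complex.X 0)) ≫ powAug J n = 0
    rw [Linear.smul_comp, Category.id_comp]
    refine ModuleCat.hom_ext (LinearMap.ext fun t => ?_)
    obtain ⟨r, hr⟩ := Ideal.Quotient.mk_surjective ((powAug J n).hom t)
    change x ^ n • (powAug J n).hom t = 0
    rw [← hr]
    exact Ideal.Quotient.eq_zero_iff_mem.2 (Ideal.mul_mem_right _ _ (Ideal.pow_mem_pow hx n))
  let s := ProjectiveResolution.liftHomotopyZero _ hzero
  have hs := s.comm i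
  rw [dNext_nat, HomologicalComplex.zero_f, add_zero] at hs
  have hp : prevD i s.hom ≫ φ = 0 := by
    rw [prevD_eq _ (show (ComplexShape.down ℕ).Rel (i + 1) i by simp), Category.assoc, hφ,
      comp_zero]
  refine ⟨(s.hom (i - 1) i ≫ φ) ≫ e.inv, ?_⟩
  rw [← Category.assoc, Iso.eq_comp_inv, he]
  have := congr($hs ≫ φ)
  rw [Preadditive.add_comp, hp, add_zero, Category.assoc] at this
  rw [← this, HomologicalComplex.id_f, Category.id_comp, HomologicalComplex.smul_f_apply,
    HomologicalComplex.id_f, Linear.smul_comp, Category.id_comp]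

/-- The inductive step for detecting injectivity on local cohomology: if `0 → K → M → L → C → 0`
is exact and the local cohomology of `K` and `L` vanishes, injectivity in degree `i + 1` on `M`
follows from injectivity in degree `i` on `C`. -/
theorem cohInj_succ {L' C' : ModuleCat.{u} R} {a : M ⟶ L} {b : L ⟶ C} (w : a ≫ b = 0)
    (hex : (ShortComplex.mk a b w).Exact) [Epi b] {a' : N ⟶ L'} {b' : L' ⟶ C'}
    (w' : a' ≫ b' = 0) {f : M ⟶ N} {g : L ⟶ L'} {h : C ⟶ C'} (hfg : a ≫ g = f ≫ a')
    (hgh : b ≫ h = g ≫ b') (hL : CohVanish J (i + 1) L) (hL' : CohVanish J i L')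
    (hK : CohVanish J (i + 1) (kernel a)) (hh : CohInj J i h) : CohInj J (i + 1) f := by
  rintro n φ hφ ⟨n₁, σ₁, hσ₁, hcob⟩
  obtain ⟨ψ, hψ⟩ := isCob_succ_iff.1 hcob
  obtain ⟨n₂, σ₂, hσ₂, hcob⟩ := hL n₁ (σ₁.f _ ≫ φ ≫ a) (by
    rw [← HomologicalComplex.Hom.comm_assoc, reassoc_of% hφ, zero_comp, comp_zero])
  obtain ⟨χ, hχ⟩ := isCob_succ_iff.1 hcob
  -- Both terms bound the image of `φ` in `L'`, so their difference is a cocycle. Once it is a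
  -- coboundary, `χ ≫ b` is a cocycle in `C` that `h` sends to a coboundary.
  obtain ⟨n₃, σ₃, hσ₃, ω, hω⟩ := hL' n₂ (χ ≫ g - σ₂.f i ≫ ψ ≫ a') (by
    rw [Preadditive.comp_sub, ← reassoc_of% hχ, ← HomologicalComplex.Hom.comm_assoc,
      ← reassoc_of% hψ, hfg, sub_self])
  obtain ⟨n₄, σ₄, hσ₄, ρ, hρ⟩ := hh n₃ (σ₃.f i ≫ χ ≫ b) (by
      rw [← HomologicalComplex.Hom.comm_assoc, ← reassoc_of% hχ, w]
      simp only [comp_zero])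
    ⟨n₃, 𝟙 _, .id, ω ≫ b', by
      rw [← reassoc_of% hω, HomologicalComplex.id_f, Category.id_comp]
      simp only [Preadditive.sub_comp, Category.assoc, w', comp_zero,
        sub_zero, hgh]⟩
  -- Lifting `ρ` through the epimorphism `b` corrects `χ` so that it dies in `C` and hence comes
  -- from `ξ` in `M`. Then `φ' - d ξ` lands in the kernel of `a`.
  let χ' := σ₄.f i ≫ σ₃.f i ≫ χ - (powRes J n₄).complex.d i (i - 1) ≫ Projective.factorThru ρ b
  have hχ' : χ' ≫ b = 0 := by
    simp only [χ', Preadditive.sub_comp, Category.assoc, Projective.factorThru_comp, hρ, sub_self]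
  let ξ : (powRes J n₄).complex.X i ⟶ M := hex.liftFromProjective χ' hχ'
  have hξ : ξ ≫ a = χ' := hex.liftFromProjective_comp _ _
  let φ' := σ₄.f (i + 1) ≫ σ₃.f (i + 1) ≫ σ₂.f (i + 1) ≫ σ₁.f (i + 1) ≫ φ
  have hφ' : (φ' - (powRes J n₄).complex.d (i + 1) i ≫ ξ) ≫ a = 0 := by
    simp only [φ', Preadditive.sub_comp, Category.assoc, hξ, hχ, χ', Preadditive.comp_sub,
      HomologicalComplex.Hom.comm_assoc, HomologicalComplex.d_comp_d_assoc, zero_comp, sub_zero,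
      sub_self]
  obtain ⟨n₅, σ₅, hσ₅, hcob⟩ := hK n₄ (kernel.lift a _ hφ') (by
    rw [← cancel_mono (kernel.ι a), Category.assoc, kernel.lift_ι, zero_comp,
      Preadditive.comp_sub, HomologicalComplex.d_comp_d_assoc, zero_comp, sub_zero]
    simp only [φ', ← HomologicalComplex.Hom.comm_assoc, hφ, comp_zero])
  obtain ⟨κ, hκ⟩ := isCob_succ_iff.1 hcob
  refine ⟨n₅, σ₅ ≫ σ₄ ≫ σ₃ ≫ σ₂ ≫ σ₁, hσ₅.comp (hσ₄.comp (hσ₃.comp (hσ₂.comp hσ₁))),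
    isCob_succ_iff.2 ⟨σ₅.f i ≫ ξ + κ ≫ kernel.ι a, ?_⟩⟩
  have h₅ := congr($hκ ≫ kernel.ι a)
  rw [Category.assoc, Category.assoc, kernel.lift_ι, Preadditive.comp_sub] at h₅
  simp only [HomologicalComplex.comp_f, Category.assoc]
  change σ₅.f (i + 1) ≫ φ' = (powRes J n₅).complex.d (i + 1) i ≫ _
  rw [Preadditive.comp_add]
  refine (sub_eq_iff_eq_add'.1 h₅).trans ?_
  rw [HomologicalComplex.Hom.comm_assoc]

end Vanishing

/-! ### Power torsion modules have no higher local cohomology -/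

section PowerTorsion

open CategoryTheory Opposite Limits

variable {R : Type u} [CommRing R] (J : Ideal R)

/-- Every element of `M` is annihilated by a power of `J`. -/
def IsPowerTorsion (M : Type*) [AddCommGroup M] [Module R M] : Prop :=
  ∀ z : M, ∃ n : ℕ, ∀ r ∈ J ^ n, r • z = 0

/-- The submodule of elements annihilated by a power of `J`. -/
def powerTorsion (M : Type*) [AddCommGroup M] [Module R M] : Submodule R M where
  carrier := {z | ∃ n : ℕ, ∀ r ∈ J ^ n, r • z = 0}
  add_mem' := by
    rintro a b ⟨n, hn⟩ ⟨k, hk⟩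
    refine ⟨n + k, fun r hr => ?_⟩
    rw [smul_add, hn r (Ideal.pow_le_pow_right (Nat.le_add_right _ _) hr),
      hk r (Ideal.pow_le_pow_right (Nat.le_add_left _ _) hr), add_zero]
  zero_mem' := ⟨0, fun r _ => smul_zero r⟩
  smul_mem' := by
    rintro c z ⟨n, hn⟩
    exact ⟨n, fun r hr => by rw [smul_comm, hn r hr, smul_zero]⟩

lemma isPowerTorsion_powerTorsion (M : Type*) [AddCommGroup M] [Module R M] :
    IsPowerTorsion J (powerTorsion J M) := by
  rintro ⟨z, n, hn⟩
  exact ⟨n, fun r hr => Subtype.ext (hn r hr)⟩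

variable {J}

/-- A finitely generated power torsion image is annihilated by a single power. -/
lemma IsPowerTorsion.exists_pow {M N : Type*} [AddCommGroup M] [Module R M] [AddCommGroup N]
    [Module R N] [IsNoetherian R N] (hM : IsPowerTorsion J M) (g : N →ₗ[R] M) :
    ∃ n : ℕ, ∀ r ∈ J ^ n, ∀ x, r • g x = 0 := by
  let T : ℕ →o Submodule R N :=
    { toFun n :=
        { carrier := {x | ∀ r ∈ J ^ n, r • g x = 0}
          add_mem' ha hb r hr := by rw [map_add, smul_add, ha r hr, hb r hr, add_zero]
          zero_mem' r _ := by rw [map_zero, smul_zero]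
          smul_mem' c x hx r hr := by rw [map_smul, smul_comm, hx r hr, smul_zero] }
      monotone' n k h x hx r hr := hx r (Ideal.pow_le_pow_right h hr) }
  obtain ⟨n, hn⟩ := monotone_stabilizes_iff_noetherian.2 ‹_› T
  refine ⟨n, fun r hr x => ?_⟩
  obtain ⟨k, hk⟩ := hM (g x)
  have h1 : x ∈ T k := hk
  have h2 : x ∈ T n := by
    rw [hn (max n k) (le_max_left _ _)]
    exact T.monotone (le_max_right _ _) h1
  exact h2 r hr

/-- Baer's criterion with Artin–Rees: a map `g` from `I` to the torsion of `E` is killed by some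
J^n, so it vanishes on I ∩ J^(n+k) and factors through a submodule of R/J^(n+k). Any extension from
R/J^(n+k) to `E` has torsion image. -/
lemma injective_powerTorsion [IsNoetherianRing R] (J : Ideal R) (E : Type u) [AddCommGroup E]
    [Module R E] [Module.Injective R E] : Module.Injective R (powerTorsion J E) := by
  refine Module.Baer.injective fun I g => ?_
  obtain ⟨n, hn⟩ := (isPowerTorsion_powerTorsion J E).exists_pow g
  obtain ⟨k, hk⟩ := Ideal.exists_pow_inf_eq_pow_smul J (I : Submodule R R)
  have hker : Submodule.comap I.subtype (J ^ (n + k)) ≤ LinearMap.ker g := by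
    intro x hx
    have h1 : (x : R) ∈ (J ^ (n + k) • ⊤ ⊓ I : Submodule R R) := ⟨by simpa using hx, x.2⟩
    rw [hk _ (Nat.le_add_left k n), Nat.add_sub_cancel] at h1
    have h2 : (J ^ n • (J ^ k • ⊤ ⊓ I) : Submodule R R) ≤
        (LinearMap.ker g).map I.subtype := by
      refine Submodule.smul_le.2 fun r hr y hy => ⟨⟨r • y, I.mul_mem_left _ hy.2⟩, ?_, rfl⟩
      exact (map_smul g r ⟨y, hy.2⟩).trans (hn r hr _)
    obtain ⟨y, hy, hyx⟩ := h2 h1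
    rwa [← Subtype.ext hyx]
  obtain ⟨h, hh⟩ := Module.Injective.out
    (Submodule.mapQ (Submodule.comap I.subtype (J ^ (n + k))) (J ^ (n + k)) I.subtype le_rfl)
    (by
      rw [← LinearMap.ker_eq_bot, Submodule.ker_mapQ]
      simp)
    ((powerTorsion J E).subtype ∘ₗ (Submodule.liftQ _ g hker))
  refine ⟨(h ∘ₗ Submodule.mkQ (J ^ (n + k))).codRestrict _ fun r => ⟨n + k, fun s hs => ?_⟩, ?_⟩
  · change s • h (Submodule.Quotient.mk r) = 0
    rw [← map_smul, ← Submodule.Quotient.mk_smul, smul_eq_mul,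
      (Submodule.Quotient.mk_eq_zero _).2 (Ideal.mul_mem_right _ _ hs), map_zero]
  · intro x hx
    exact Subtype.ext (hh (Submodule.Quotient.mk ⟨x, hx⟩))

lemma IsPowerTorsion.of_surjective {M N : Type*} [AddCommGroup M] [Module R M] [AddCommGroup N]
    [Module R N] (hM : IsPowerTorsion J M) (g : M →ₗ[R] N) (hg : Function.Surjective g) :
    IsPowerTorsion J N := by
  intro z
  obtain ⟨z, rfl⟩ := hg z
  obtain ⟨n, hn⟩ := hM z
  exact ⟨n, fun r hr => by rw [← map_smul, hn r hr, map_zero]⟩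

/-- Over a Noetherian ring, a power torsion module embeds in an injective power torsion module. -/
lemma IsPowerTorsion.exists_injective [IsNoetherianRing R] {K : ModuleCat.{u} R}
    (hK : IsPowerTorsion J K) :
    ∃ (E : ModuleCat.{u} R) (ι : K ⟶ E), Injective E ∧ Mono ι ∧ IsPowerTorsion J E := by
  let E₀ := Injective.under K
  have : Module.Injective R E₀ :=
    have : Injective (ModuleCat.of R E₀) := inferInstanceAs (Injective (Injective.under K))
    Module.injective_module_of_injective_object R E₀
  have := injective_powerTorsion J E₀
  have hι : Function.Injective (Injective.ι K).hom :=
    (ModuleCat.mono_iff_injective _).1 inferInstance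
  let ι : K →ₗ[R] powerTorsion J E₀ := (Injective.ι K).hom.codRestrict _ fun z => by
    obtain ⟨n, hn⟩ := hK z
    exact ⟨n, fun r hr => by rw [← map_smul, hn r hr, map_zero]⟩
  refine ⟨ModuleCat.of R (powerTorsion J E₀), ModuleCat.ofHom ι,
    Module.injective_object_of_injective_module R _, ?_, isPowerTorsion_powerTorsion J E₀⟩
  rw [ModuleCat.mono_iff_injective]
  exact fun a b hab => hι (congrArg Subtype.val hab)

variable {n i : ℕ}

lemma epi_powAug : Epi (powAug J n) :=
  inferInstanceAs (Epi ((powRes J n).π.f 0))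

lemma d_comp_powAug : (powRes J n).complex.d 1 0 ≫ powAug J n = 0 :=
  (powRes J n).complex_d_comp_π_f_zero

lemma exact_powAug : (ShortComplex.mk _ _ (d_comp_powAug (J := J) (n := n))).Exact :=
  (powRes J n).exact₀

/-- If an element `θ : R/J^n → Q` lifts along `q : E → Q` with `E` power torsion, it lifts after
passing to a higher power. -/
lemma exists_lift_of_isPowerTorsion {E Q : ModuleCat.{u} R} (hE : IsPowerTorsion J E) (q : E ⟶ Q)
    [Epi q] (θ : ModuleCat.of R (R ⧸ J ^ n) ⟶ Q) :
    ∃ (n' : ℕ) (h : n ≤ n') (θ' : ModuleCat.of R (R ⧸ J ^ n') ⟶ E), powProj J h ≫ θ = θ' ≫ q := by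
  obtain ⟨e, he⟩ := (ModuleCat.epi_iff_surjective q).1 ‹_› (θ.hom (Ideal.Quotient.mk _ 1))
  obtain ⟨k, hk⟩ := hE e
  refine ⟨n + k, Nat.le_add_right _ _, ModuleCat.ofHom
    (Submodule.liftQ (J ^ (n + k)) (LinearMap.toSpanSingleton R E e) fun r hr =>
      hk r (Ideal.pow_le_pow_right (Nat.le_add_left _ _) hr)), ?_⟩
  refine ModuleCat.hom_ext (LinearMap.ext fun x => ?_)
  obtain ⟨r, rfl⟩ := Ideal.Quotient.mk_surjective x
  change θ.hom (Submodule.Quotient.mk r) = q.hom (r • e)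
  have he' : q.hom e = θ.hom (Submodule.Quotient.mk 1) := he
  rw [map_smul, he', ← map_smul, ← Submodule.Quotient.mk_smul, smul_eq_mul, mul_one]

/-- The positive degree local cohomology of a power torsion module over a Noetherian ring
vanishes. -/
theorem cohVanish_of_isPowerTorsion [IsNoetherianRing R] {K : ModuleCat.{u} R}
    (hK : IsPowerTorsion J K) (i : ℕ) : CohVanish J (i + 1) K := by
  induction i generalizing K with
  | zero =>
    intro n φ hφ
    obtain ⟨E, ι, _, _, hE⟩ := hK.exists_injective
    have hex : (ShortComplex.mk ι (cokernel.π ι) (cokernel.condition ι)).Exact :=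
      ShortComplex.exact_of_g_is_cokernel _ (cokernelIsCokernel ι)
    let ψ := ((powRes J n).exact_succ 0).descToInjective (φ ≫ ι) (by
      dsimp only; rw [reassoc_of% hφ, zero_comp])
    have hψ : (powRes J n).complex.d 1 0 ≫ ψ = φ ≫ ι :=
      ((powRes J n).exact_succ 0).comp_descToInjective _ _
    have := epi_powAug (J := J) (n := n)
    let θ := (exact_powAug (J := J) (n := n)).desc (ψ ≫ cokernel.π ι) (by
      dsimp only; rw [reassoc_of% hψ, cokernel.condition, comp_zero])
    have hθ : powAug J n ≫ θ = ψ ≫ cokernel.π ι :=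
      (exact_powAug (J := J) (n := n)).g_desc _ _
    -- The class of `φ` is the obstruction to lifting `θ` to `E`; raising the power of J removes it.
    -- Subtracting the lift moves `ψ` into `K` without changing its coboundary.
    obtain ⟨n', h, θ', hθ'⟩ := exists_lift_of_isPowerTorsion hE (cokernel.π ι) θ
    obtain ⟨σ, hσ⟩ := exists_isTransition (J := J) h
    have hσ0 : (σ.f 0 ≫ ψ - powAug J n' ≫ θ') ≫ cokernel.π ι = 0 := by
      rw [Preadditive.sub_comp, Category.assoc, Category.assoc, ← hθ, reassoc_of% hσ.2, hθ',
        sub_self]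
    refine ⟨n', σ, hσ, isCob_succ_iff.2 ⟨hex.lift _ hσ0, ?_⟩⟩
    have hd := d_comp_powAug (J := J) (n := n')
    have hl : hex.lift _ hσ0 ≫ ι = σ.f 0 ≫ ψ - powAug J n' ≫ θ' := hex.lift_f _ _
    rw [← cancel_mono ι, Category.assoc, Category.assoc, hl, Preadditive.comp_sub,
      reassoc_of% hd, zero_comp, sub_zero, ← HomologicalComplex.Hom.comm_assoc, hψ]
  | succ i ih =>
    intro n φ hφ
    obtain ⟨E, ι, _, _, hE⟩ := hK.exists_injective
    have hex : (ShortComplex.mk ι (cokernel.π ι) (cokernel.condition ι)).Exact :=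
      ShortComplex.exact_of_g_is_cokernel _ (cokernelIsCokernel ι)
    let ψ := ((powRes J n).exact_succ (i + 1)).descToInjective (φ ≫ ι) (by
      dsimp only; rw [reassoc_of% hφ, zero_comp])
    have hψ : (powRes J n).complex.d (i + 2) (i + 1) ≫ ψ = φ ≫ ι :=
      ((powRes J n).exact_succ (i + 1)).comp_descToInjective _ _
    -- Dimension shifting: the cokernel is again power torsion, so the induction hypothesis applies
    -- to it one degree lower.
    have hQ : IsPowerTorsion J (cokernel ι : ModuleCat.{u} R) :=
      hE.of_surjective (cokernel.π ι).hom ((ModuleCat.epi_iff_surjective _).1 inferInstance)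
    obtain ⟨n', σ, hσ, hcob⟩ := ih hQ n (ψ ≫ cokernel.π ι) (by
      rw [reassoc_of% hψ, cokernel.condition, comp_zero])
    obtain ⟨ρ, hρ⟩ := isCob_succ_iff.1 hcob
    have hσ0 : (σ.f (i + 1) ≫ ψ - (powRes J n').complex.d (i + 1) i ≫
        Projective.factorThru ρ (cokernel.π ι)) ≫ cokernel.π ι = 0 := by
      rw [Preadditive.sub_comp, Category.assoc, Category.assoc, hρ, Projective.factorThru_comp,
        sub_self]
    refine ⟨n', σ, hσ, isCob_succ_iff.2 ⟨hex.lift _ hσ0, ?_⟩⟩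
    have hl : hex.lift _ hσ0 ≫ ι = _ := hex.lift_f _ _
    rw [← cancel_mono ι, Category.assoc, Category.assoc, hl, Preadditive.comp_sub,
      HomologicalComplex.d_comp_d_assoc, zero_comp, sub_zero,
      ← HomologicalComplex.Hom.comm_assoc, hψ]

end PowerTorsion

/-! ### Filter regular sequences -/

section FilterRegular

open CategoryTheory Opposite Limits

variable {R : Type u} [CommRing R] {J I : Ideal R} {M N : Type*} [AddCommGroup M] [Module R M]
  [AddCommGroup N] [Module R N] {x y : R}

/-- `y` is `J`-filter regular on `M/K`: elements of `M/K` annihilated by `y` are annihilated by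
powers of each element of `J`. -/
def IsFilterRegularOn (J : Ideal R) (y : R) (K : Submodule R M) : Prop :=
  ∀ z : M, y • z ∈ K → ∀ a ∈ J, ∃ n : ℕ, a ^ n • z ∈ K

/-- A `J`-filter regular sequence on `M`. -/
def IsFilterRegularSeq (J : Ideal R) (M : Type*) [AddCommGroup M] [Module R M]
    (xs : List R) : Prop :=
  ∀ ys y zs, xs = ys ++ y :: zs → IsFilterRegularOn J y (Ideal.ofList ys • ⊤ : Submodule R M)

lemma mem_sup_span_singleton_smul_top {z : M} :
    z ∈ ((I ⊔ Ideal.span {x}) • ⊤ : Submodule R M) ↔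
      ∃ m, z - x • m ∈ (I • ⊤ : Submodule R M) := by
  rw [Submodule.sup_smul, Submodule.mem_sup, Submodule.ideal_span_singleton_smul]
  constructor
  · rintro ⟨v, hv, w, hw, rfl⟩
    obtain ⟨m, -, rfl⟩ := (Submodule.mem_smul_pointwise_iff_exists _ _ _).1 hw
    exact ⟨m, by rwa [add_sub_cancel_right]⟩
  · rintro ⟨m, hm⟩
    exact ⟨_, hm, x • m, Submodule.smul_mem_pointwise_smul m x ⊤ trivial, sub_add_cancel _ _⟩

/-- Write M for the module modulo I. If y z = x^(n+1) m', then up to a power of a, z = x m by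
regularity modulo x. Cancelling x up to torsion gives y m ∈ x^n M, and induction on n applies to m.
-/
lemma IsFilterRegularOn.sup_pow (hx : IsFilterRegularOn J x (I • ⊤ : Submodule R M))
    (hy : IsFilterRegularOn J y ((I ⊔ Ideal.span {x}) • ⊤ : Submodule R M)) (n : ℕ) :
    IsFilterRegularOn J y ((I ⊔ Ideal.span {x ^ n}) • ⊤ : Submodule R M) := by
  induction n with
  | zero =>
    intro z _ a _
    refine ⟨0, mem_sup_span_singleton_smul_top.2 ⟨z, ?_⟩⟩
    simp
  | succ n ih =>
    intro z hz a ha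
    obtain ⟨m', hm'⟩ := mem_sup_span_singleton_smul_top.1 hz
    obtain ⟨s, hs⟩ := hy z (mem_sup_span_singleton_smul_top.2
      ⟨x ^ n • m', by rwa [smul_smul, ← pow_succ']⟩) a ha
    obtain ⟨m, hm⟩ := mem_sup_span_singleton_smul_top.1 hs
    obtain ⟨t, ht⟩ := hx (y • m - x ^ n • a ^ s • m') (by
      convert sub_mem (Submodule.smul_mem _ (a ^ s) hm') (Submodule.smul_mem _ y hm) using 1
      module) a ha
    obtain ⟨v, hv⟩ := ih (a ^ t • m) (mem_sup_span_singleton_smul_top.2 ⟨a ^ t • a ^ s • m', by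
      convert ht using 1
      module⟩) a ha
    obtain ⟨m₂, hm₂⟩ := mem_sup_span_singleton_smul_top.1 hv
    refine ⟨v + t + s, mem_sup_span_singleton_smul_top.2 ⟨m₂, ?_⟩⟩
    convert add_mem (Submodule.smul_mem _ (a ^ (v + t)) hm) (Submodule.smul_mem _ x hm₂) using 1
    module

lemma ofList_cons_eq_sup (x : R) (xs : List R) :
    Ideal.ofList (x :: xs) = Ideal.ofList xs ⊔ Ideal.span {x} := by
  rw [Ideal.ofList_cons, sup_comm]

lemma ofList_concat_eq_sup (xs : List R) (x : R) :
    Ideal.ofList (xs ++ [x]) = Ideal.ofList xs ⊔ Ideal.span {x} := by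
  rw [Ideal.ofList_append, Ideal.ofList_singleton]

/-- The first element of a filter regular sequence is filter regular modulo the others. -/
lemma IsFilterRegularSeq.head_isFilterRegularOn {xs : List R} (h : IsFilterRegularSeq J M (x :: xs))
    (ys : List R) (hys : ys <+: xs) :
    IsFilterRegularOn J x (Ideal.ofList ys • ⊤ : Submodule R M) := by
  induction ys using List.reverseRecOn with
  | nil => exact h [] x xs rfl
  | append_singleton ys y ih =>
    obtain ⟨zs, hzs⟩ := hys
    have hy := h (x :: ys) y zs (by simp [← hzs])
    have hx := ih ⟨y :: zs, by simp [← hzs]⟩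
    intro z hz a ha
    rw [ofList_concat_eq_sup] at *
    obtain ⟨m, hm⟩ := mem_sup_span_singleton_smul_top.1 hz
    -- A relation x z = y m modulo `ys` shows that y kills m modulo `x :: ys`. So up to a power of
    -- a, m = x m', and x can then be cancelled using the induction hypothesis.
    obtain ⟨s, hs⟩ := hy m (by
      rw [ofList_cons_eq_sup]
      refine mem_sup_span_singleton_smul_top.2 ⟨z, ?_⟩
      rw [← neg_sub]
      exact neg_mem hm) a ha
    rw [ofList_cons_eq_sup] at hs
    obtain ⟨m', hm'⟩ := mem_sup_span_singleton_smul_top.1 hs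
    obtain ⟨t, ht⟩ := hx (a ^ s • z - y • m') (by
      convert add_mem (Submodule.smul_mem _ (a ^ s) hm) (Submodule.smul_mem _ y hm') using 1
      module) a ha
    refine ⟨t + s, mem_sup_span_singleton_smul_top.2 ⟨a ^ t • m', ?_⟩⟩
    convert ht using 1
    module

end FilterRegular

/-! ### The cokernel of M → M_x and the limit of the quotients -/

section LocalizationCokernel

open CategoryTheory Opposite Limits

variable {R : Type u} [CommRing R] {J I : Ideal R} {x : R}
  {M L C M' L' C' : Type*} [AddCommGroup M] [Module R M] [AddCommGroup L] [Module R L]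
  [AddCommGroup C] [Module R C] [AddCommGroup M'] [Module R M'] [AddCommGroup L'] [Module R L']
  [AddCommGroup C'] [Module R C']

/-- `M → L → C` is isomorphic to `M → M_x → M_x/M`. -/
structure IsLocalizationCokernel (x : R) (a : M →ₗ[R] L) (b : L →ₗ[R] C) : Prop where
  bijective : Function.Bijective (fun l : L => x • l)
  exists_smul_eq : ∀ l : L, ∃ (n : ℕ) (z : M), x ^ n • l = a z
  exists_smul_eq_zero : ∀ z : M, a z = 0 → ∃ n : ℕ, x ^ n • z = 0
  surjective : Function.Surjective b
  exact : Function.Exact a b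

variable {a : M →ₗ[R] L} {b : L →ₗ[R] C} {a' : M' →ₗ[R] L'} {b' : L' →ₗ[R] C'}

lemma map_mem_smul_top (f : M →ₗ[R] L) {z : M} (hz : z ∈ (I • ⊤ : Submodule R M)) :
    f z ∈ (I • ⊤ : Submodule R L) :=
  Submodule.smul_top_le_comap_smul_top I f hz

/-- C/IC is the direct limit of the quotients M/(I, x^s)M, the fraction z/x^n corresponding to the
class of z at s = n. This lemma and the next one are the two directions of that description on
elements. -/
lemma IsLocalizationCokernel.mem_smul_top (h : IsLocalizationCokernel x a b) {l : L} {z : M}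
    {n k : ℕ} (hl : x ^ n • l = a z)
    (hz : x ^ k • z ∈ ((I ⊔ Ideal.span {x ^ (n + k)}) • ⊤ : Submodule R M)) :
    b l ∈ (I • ⊤ : Submodule R C) := by
  obtain ⟨m, hm⟩ := mem_sup_span_singleton_smul_top.1 hz
  let e : L ≃ₗ[R] L := LinearEquiv.ofBijective (LinearMap.lsmul R L (x ^ (n + k)))
    (bijective_pow_smul h.bijective _)
  have h1 : a (x ^ k • z - x ^ (n + k) • m) = e (l - a m) := by
    change _ = x ^ (n + k) • (l - a m)
    rw [map_sub, map_smul, map_smul, ← hl]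
    module
  have h2 : e.symm (a (x ^ k • z - x ^ (n + k) • m)) ∈ (I • ⊤ : Submodule R L) :=
    map_mem_smul_top e.symm.toLinearMap (map_mem_smul_top a hm)
  rw [h1, e.symm_apply_apply] at h2
  have h3 := map_mem_smul_top b h2
  rwa [map_sub, h.exact.apply_apply_eq_zero, sub_zero] at h3

lemma IsLocalizationCokernel.exists_mem_smul_top (h : IsLocalizationCokernel x a b) {l : L} {z : M}
    {n : ℕ} (hl : x ^ n • l = a z) (hb : b l ∈ (I • ⊤ : Submodule R C)) :
    ∃ k : ℕ, x ^ k • z ∈ ((I ⊔ Ideal.span {x ^ (n + k)}) • ⊤ : Submodule R M) := by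
  have h1 : (I • ⊤ : Submodule R C) = (I • ⊤ : Submodule R L).map b := by
    rw [Submodule.map_smul'', Submodule.map_top, LinearMap.range_eq_top.2 h.surjective]
  rw [h1] at hb
  obtain ⟨l', hl', hbl⟩ := hb
  obtain ⟨m, hm⟩ := (h.exact (l - l')).1 (by rw [map_sub, hbl, sub_self])
  have h2 : ∃ c : ℕ, ∃ j ∈ (I • ⊤ : Submodule R M), x ^ c • l' = a j := by
    refine Submodule.smul_induction_on hl' (fun r hr t _ => ?_) ?_
    · obtain ⟨c, w, hw⟩ := h.exists_smul_eq t
      exact ⟨c, r • w, Submodule.smul_mem_smul hr trivial, by rw [smul_comm, hw, map_smul]⟩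
    · rintro t₁ t₂ ⟨c₁, j₁, hj₁, h₁⟩ ⟨c₂, j₂, hj₂, h₂⟩
      refine ⟨c₁ + c₂, x ^ c₂ • j₁ + x ^ c₁ • j₂, add_mem (Submodule.smul_mem _ _ hj₁)
        (Submodule.smul_mem _ _ hj₂), ?_⟩
      rw [map_add, map_smul, map_smul, ← h₁, ← h₂]
      module
  obtain ⟨c, j, hj, hcj⟩ := h2
  obtain ⟨d, hd⟩ := h.exists_smul_eq_zero (x ^ c • z - x ^ (n + c) • m - x ^ n • j) (by
    rw [map_sub, map_sub, map_smul, map_smul, map_smul, ← hl, hm, ← hcj]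
    module)
  refine ⟨c + d, mem_sup_span_singleton_smul_top.2 ⟨m, ?_⟩⟩
  convert Submodule.smul_mem _ (x ^ (d + n)) hj using 1
  rw [← sub_eq_zero, ← hd]
  module

/-- Filter regular sequences descend to the cokernel of the localization at the first element. -/
lemma IsFilterRegularSeq.of_isLocalizationCokernel {xs : List R}
    (hM : IsFilterRegularSeq J M (x :: xs)) (h : IsLocalizationCokernel x a b) :
    IsFilterRegularSeq J C xs := by
  intro ys y zs hxs c hc r hr
  obtain ⟨l, rfl⟩ := h.surjective c
  obtain ⟨n, z, hz⟩ := h.exists_smul_eq l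
  rw [← map_smul] at hc
  obtain ⟨k, hk⟩ := h.exists_mem_smul_top (n := n) (z := y • z)
    (by rw [smul_comm, hz, map_smul]) hc
  have hy := hM (x :: ys) y zs (by simp [hxs])
  rw [ofList_cons_eq_sup] at hy
  obtain ⟨s, hs⟩ := (hM.head_isFilterRegularOn ys ⟨_, hxs.symm⟩).sup_pow hy (n + k) (x ^ k • z)
    (by rwa [smul_comm]) r hr
  refine ⟨s, ?_⟩
  rw [← map_smul]
  exact h.mem_smul_top (n := n) (k := k) (z := r ^ s • z) (by rw [smul_comm, hz, map_smul])
    (by rwa [smul_comm])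

/-- The ideal generated by the `n`-th powers of the elements of a list. -/
def powIdeal (xs : List R) (n : ℕ) : Ideal R :=
  Ideal.ofList (xs.map (· ^ n))

lemma powIdeal_cons (x : R) (xs : List R) (n : ℕ) :
    powIdeal (x :: xs) n = powIdeal xs n ⊔ Ideal.span {x ^ n} :=
  ofList_cons_eq_sup _ _

/-- This makes multiplication by the k-th power of the product a well-defined transition map from
level n to level n + k. -/
lemma prod_pow_mul_mem_powIdeal {xs : List R} {n : ℕ} (k : ℕ) {r : R} (hr : r ∈ powIdeal xs n) :
    xs.prod ^ k * r ∈ powIdeal xs (n + k) := by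
  refine Submodule.span_induction (fun r hr => ?_) (by simp)
    (fun _ _ _ _ h₁ h₂ => by rw [mul_add]; exact add_mem h₁ h₂)
    (fun c _ _ h => by rw [smul_eq_mul, mul_left_comm]; exact Ideal.mul_mem_left _ _ h) hr
  obtain ⟨s, hs, rfl⟩ := List.mem_map.1 hr
  obtain ⟨t, ht⟩ := List.dvd_prod hs
  have : xs.prod ^ k * s ^ n = t ^ k * s ^ (n + k) := by rw [ht]; ring
  rw [this]
  exact Ideal.mul_mem_left _ _ (Ideal.subset_span (List.mem_map.2 ⟨s, hs, rfl⟩))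

lemma prod_pow_smul_mem {xs : List R} {n : ℕ} (k : ℕ) {z : M}
    (hz : z ∈ (powIdeal xs n • ⊤ : Submodule R M)) :
    xs.prod ^ k • z ∈ (powIdeal xs (n + k) • ⊤ : Submodule R M) := by
  refine Submodule.smul_induction_on hz (fun r hr t _ => ?_) fun _ _ h₁ h₂ => by
    rw [smul_add]; exact add_mem h₁ h₂
  rw [smul_smul]
  exact Submodule.smul_mem_smul (prod_pow_mul_mem_powIdeal k hr) trivial

/-- The map induced by `f` on the direct limits of the quotients `M/(x₁^n, …, x_t^n)M` is
injective. -/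
def LimInjective (xs : List R) (f : M →ₗ[R] M') : Prop :=
  ∀ (n : ℕ) (z : M), f z ∈ (powIdeal xs n • ⊤ : Submodule R M') →
    ∃ k : ℕ, xs.prod ^ k • z ∈ (powIdeal xs (n + k) • ⊤ : Submodule R M)

lemma LimInjective.of_isLocalizationCokernel {xs : List R} {f : M →ₗ[R] M'} {g : L →ₗ[R] L'}
    {h : C →ₗ[R] C'} (hf : LimInjective (x :: xs) f) (hM : IsLocalizationCokernel x a b)
    (hM' : IsLocalizationCokernel x a' b') (hg : g ∘ₗ a = a' ∘ₗ f) (hh : h ∘ₗ b = b' ∘ₗ g) :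
    LimInjective xs h := by
  intro n c hc
  obtain ⟨l, rfl⟩ := hM.surjective c
  obtain ⟨s, z, hz⟩ := hM.exists_smul_eq l
  have h1 : h (b l) = b' (g l) := congr($hh l)
  have h2 : g (a z) = a' (f z) := congr($hg z)
  rw [h1] at hc
  obtain ⟨k, hk⟩ := hM'.exists_mem_smul_top (by rw [← map_smul, hz, h2]) hc
  obtain ⟨m, hm⟩ := mem_sup_span_singleton_smul_top.1 hk
  -- The exponents are n on `xs` but s + k on `x`. Multiplying by `x ^ n` and by `xs.prod ^ (s + k)`
  -- brings all of them to n + (s + k).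
  obtain ⟨k', hk'⟩ := hf (n + (s + k)) (x ^ n • xs.prod ^ (s + k) • x ^ k • z) (by
    rw [powIdeal_cons]
    refine mem_sup_span_singleton_smul_top.2 ⟨xs.prod ^ (s + k) • m, ?_⟩
    convert Submodule.smul_mem _ (x ^ n) (prod_pow_smul_mem (s + k) hm) using 1
    simp only [map_smul]
    module)
  refine ⟨s + k + k', ?_⟩
  rw [← map_smul]
  refine hM.mem_smul_top (n := s) (k := n + k + k') (z := xs.prod ^ (s + k + k') • z)
    (by rw [smul_comm, hz, map_smul]) ?_
  rw [powIdeal_cons, List.prod_cons,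
    show x ^ (n + (s + k) + k') = x ^ (s + (n + k + k')) by ring,
    show n + (s + k) + k' = n + (s + k + k') by ring] at hk'
  convert hk' using 1
  module

lemma isLocalizationCokernel_mkQ (a : M →ₗ[R] L) [IsLocalizedModule (Submonoid.powers x) a] :
    IsLocalizationCokernel x a (LinearMap.range a).mkQ where
  bijective := (Module.End.isUnit_iff _).1
    (IsLocalizedModule.map_units a (⟨x, Submonoid.mem_powers x⟩ : Submonoid.powers x))
  exists_smul_eq l := by
    obtain ⟨⟨z, s⟩, hs⟩ := IsLocalizedModule.surj (Submonoid.powers x) a l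
    obtain ⟨n, hn⟩ := s.2
    exact ⟨n, z, (congrArg (· • l) hn).trans hs⟩
  exists_smul_eq_zero z hz := by
    obtain ⟨s, hs⟩ := (IsLocalizedModule.eq_zero_iff (Submonoid.powers x) a).1 hz
    obtain ⟨n, hn⟩ := s.2
    exact ⟨n, (congrArg (· • z) hn).trans hs⟩
  surjective := Submodule.mkQ_surjective _
  exact := LinearMap.exact_map_mkQ_range a

end LocalizationCokernel

/-! ### Testing injectivity on the limit -/

section Criterion

open CategoryTheory Opposite Limits

variable {R : Type u} [CommRing R] {J : Ideal R}

lemma isPowerTorsion_of_forall_pow [IsNoetherianRing R] {K : Type*} [AddCommGroup K] [Module R K]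
    (h : ∀ z : K, ∀ a ∈ J, ∃ n : ℕ, a ^ n • z = 0) : IsPowerTorsion J K := by
  intro z
  let I : Ideal R := LinearMap.ker (LinearMap.toSpanSingleton R K z)
  have hJ : J ≤ I.radical :=
    fun a ha => (h z a ha).imp fun n hn => hn
  obtain ⟨n, hn⟩ := Ideal.exists_pow_le_of_le_radical_of_fg hJ (IsNoetherian.noetherian J)
  exact ⟨n, fun r hr => hn hr⟩

/-- Used to see that the kernel of M → M_x is power torsion. -/
lemma IsFilterRegularOn.exists_pow_smul_eq_zero {M : Type*} [AddCommGroup M] [Module R M] {x : R}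
    (hx : IsFilterRegularOn J x (⊥ : Submodule R M)) {n : ℕ} {z : M} (hz : x ^ n • z = 0)
    {r : R} (hr : r ∈ J) : ∃ k : ℕ, r ^ k • z = 0 := by
  induction n generalizing z with
  | zero => exact ⟨0, by simpa using hz⟩
  | succ n ih =>
    rw [pow_succ', mul_smul] at hz
    obtain ⟨k, hk⟩ := hx _ hz r hr
    rw [Submodule.mem_bot, smul_comm] at hk
    obtain ⟨k', hk'⟩ := ih hk
    exact ⟨k' + k, by rw [pow_add, mul_smul, hk']⟩

/-- Injectivity of `H^{i+1}_J(f)` follows from injectivity of `H^i_J` of the map induced by `f` on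
the cokernels `M_x/M` of localization maps. -/
theorem CohInj.of_isLocalizationCokernel [IsNoetherianRing R] {x : R} (hx : x ∈ J)
    {M N L L' C C' : ModuleCat.{u} R} {a : M ⟶ L} {b : L ⟶ C} {a' : N ⟶ L'} {b' : L' ⟶ C'}
    (hM : IsLocalizationCokernel x a.hom b.hom) (hN : IsLocalizationCokernel x a'.hom b'.hom)
    {f : M ⟶ N} {g : L ⟶ L'} {h : C ⟶ C'} (hfg : a ≫ g = f ≫ a') (hgh : b ≫ h = g ≫ b')
    (h0 : IsFilterRegularOn J x (⊥ : Submodule R M)) {i : ℕ} (hh : CohInj J i h) :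
    CohInj J (i + 1) f := by
  have w : a ≫ b = 0 := ModuleCat.hom_ext (LinearMap.ext fun z => hM.exact.apply_apply_eq_zero z)
  have w' : a' ≫ b' = 0 :=
    ModuleCat.hom_ext (LinearMap.ext fun z => hN.exact.apply_apply_eq_zero z)
  have : Epi b := (ModuleCat.epi_iff_surjective _).2 hM.surjective
  have hex : (ShortComplex.mk a b w).Exact :=
    (ShortComplex.moduleCat_exact_iff _).2 fun l hl => (hM.exact l).1 hl
  refine cohInj_succ w hex w' hfg hgh (cohVanish_of_bijective hx hM.bijective)
    (cohVanish_of_bijective hx hN.bijective)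
    (cohVanish_of_isPowerTorsion (isPowerTorsion_of_forall_pow fun z r hr => ?_) _) hh
  have hι : Function.Injective (kernel.ι a).hom :=
    (ModuleCat.mono_iff_injective _).1 inferInstance
  obtain ⟨n, hn⟩ := hM.exists_smul_eq_zero _ congr($(kernel.condition a).hom z)
  obtain ⟨k, hk⟩ := h0.exists_pow_smul_eq_zero hn hr
  exact ⟨k, hι ((map_smul _ _ _).trans (hk.trans (map_zero _).symm))⟩

/-- Injectivity of `H^t_J(f)` follows from injectivity of `f` on the direct limit of the quotients
modulo powers of a filter regular sequence of length `t` on the source. -/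
theorem cohInj_of_limInjective [IsNoetherianRing R] (xs : List R) (hxs : ∀ x ∈ xs, x ∈ J)
    {M N : ModuleCat.{u} R} (hM : IsFilterRegularSeq J M xs) (f : M ⟶ N)
    (hf : LimInjective xs f.hom) : CohInj J xs.length f := by
  induction xs generalizing M N with
  | nil =>
    -- For the empty sequence all quotients are the module itself, so the hypothesis says that `f`
    -- is injective.
    have : Mono f := by
      rw [ModuleCat.mono_iff_injective]
      refine (injective_iff_map_eq_zero f.hom).2 fun z hz => ?_
      obtain ⟨k, hk⟩ := hf 0 z (by rw [hz]; exact zero_mem _)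
      simpa [powIdeal] using hk
    exact cohInj_zero f
  | cons x xs ih =>
    let a := LocalizedModule.mkLinearMap (Submonoid.powers x) M
    let a' := LocalizedModule.mkLinearMap (Submonoid.powers x) N
    have ha : IsLocalizationCokernel x a (LinearMap.range a).mkQ := isLocalizationCokernel_mkQ _
    have ha' : IsLocalizationCokernel x a' (LinearMap.range a').mkQ := isLocalizationCokernel_mkQ _
    obtain ⟨g, hg⟩ : ∃ g, g ∘ₗ a = a' ∘ₗ f.hom :=
      ⟨_, IsLocalizedModule.map_comp (Submonoid.powers x) a a' f.hom⟩
    let h := Submodule.mapQ (LinearMap.range a) (LinearMap.range a') g (by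
      rintro _ ⟨z, rfl⟩
      exact ⟨f.hom z, congr($hg z).symm⟩)
    have hh : h ∘ₗ (LinearMap.range a).mkQ = (LinearMap.range a').mkQ ∘ₗ g :=
      Submodule.mapQ_mkQ _ _ _
    have h0 := hM [] x xs rfl
    rw [Ideal.ofList_nil, Submodule.bot_smul] at h0
    exact CohInj.of_isLocalizationCokernel (hxs x (by simp)) (a := ModuleCat.ofHom a)
      (a' := ModuleCat.ofHom a') (b := ModuleCat.ofHom (LinearMap.range a).mkQ)
      (b' := ModuleCat.ofHom (LinearMap.range a').mkQ) (g := ModuleCat.ofHom g) ha ha'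
      (ModuleCat.hom_ext hg) (ModuleCat.hom_ext hh) h0
      (ih (fun y hy => hxs y (by simp [hy])) (hM.of_isLocalizationCokernel ha)
        (ModuleCat.ofHom h) (hf.of_isLocalizationCokernel ha ha' hg hh))

end Criterion

/-! ### Filter regular sequences of parameters -/

section Parameters

open IsLocalRing

variable {R : Type u} [CommRing R]

lemma List.forall_eq_append_cons_concat {α : Type*} {P : List α → α → Prop} {xs : List α} {y : α}
    (h : ∀ ys z zs, xs = ys ++ z :: zs → P ys z) (hy : P xs y) :
    ∀ ys z zs, xs ++ [y] = ys ++ z :: zs → P ys z := by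
  intro ys z zs hzs
  rcases List.eq_nil_or_concat zs with rfl | ⟨zs', t, rfl⟩
  · obtain ⟨rfl, h2⟩ := List.append_inj' hzs rfl
    obtain rfl : y = z := by simpa using h2
    exact hy
  · refine h ys z zs' (List.append_inj' (s₁ := xs) (t₁ := [y]) (t₂ := [t]) ?_ rfl).1
    simpa using hzs

/-- The dimension of `R/I` drops by one modulo `y`. -/
def DimDrop (I : Ideal R) (y : R) : Prop :=
  ringKrullDim (R ⧸ I ⊔ Ideal.span {y}) + 1 = ringKrullDim (R ⧸ I)

/-- The dimensions depend only on zero loci; this lets parameters be replaced by their powers. -/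
lemma DimDrop.congr {I I' : Ideal R} {y y' : R} (h : DimDrop I y)
    (hI : PrimeSpectrum.zeroLocus (I : Set R) = PrimeSpectrum.zeroLocus I')
    (hy : PrimeSpectrum.zeroLocus {y} = PrimeSpectrum.zeroLocus {y'}) : DimDrop I' y' := by
  unfold DimDrop at *
  rw [ringKrullDim_quotient, ringKrullDim_quotient] at *
  have : PrimeSpectrum.zeroLocus ((I ⊔ Ideal.span {y} : Ideal R) : Set R) =
      PrimeSpectrum.zeroLocus ((I' ⊔ Ideal.span {y'} : Ideal R) : Set R) := by
    rw [PrimeSpectrum.zeroLocus_sup, PrimeSpectrum.zeroLocus_sup, PrimeSpectrum.zeroLocus_span,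
      PrimeSpectrum.zeroLocus_span, hI, hy]
  rw [← hI, ← this, h]

lemma dimDrop_of_notMem_minimalPrimes [IsLocalRing R] [IsNoetherianRing R] {I : Ideal R} {y : R}
    (hy : y ∈ maximalIdeal R) (h : ∀ p ∈ I.minimalPrimes, y ∉ p) : DimDrop I y := by
  have h1 := Module.supportDim_quotSMulTop_succ_eq_of_notMem_minimalPrimes_of_mem_maximalIdeal
    (M := R ⧸ I) (x := y) (by rwa [Ideal.annihilator_quotient]) hy
  have h2 : Module.support R (R ⧸ I) = PrimeSpectrum.zeroLocus (I : Set R) := by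
    rw [Module.support_eq_zeroLocus, Ideal.annihilator_quotient]
  unfold Module.supportDim at h1
  rw [Module.support_quotSMulTop, h2] at h1
  unfold DimDrop
  rw [ringKrullDim_quotient, ringKrullDim_quotient, PrimeSpectrum.zeroLocus_sup,
    PrimeSpectrum.zeroLocus_span, h1]

/-- A list of elements successively lowering the dimension by one. -/
def IsParameterList (xs : List R) : Prop :=
  ∀ ys y zs, xs = ys ++ y :: zs → DimDrop (Ideal.ofList ys) y

lemma zeroLocus_pow_singleton (y : R) {n : ℕ} (hn : n ≠ 0) :
    PrimeSpectrum.zeroLocus {y} = PrimeSpectrum.zeroLocus {y ^ n} := by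
  ext p
  simp [PrimeSpectrum.mem_zeroLocus, p.2.pow_mem_iff_mem n (Nat.pos_of_ne_zero hn)]

lemma zeroLocus_powIdeal (xs : List R) {n : ℕ} (hn : n ≠ 0) :
    PrimeSpectrum.zeroLocus (Ideal.ofList xs : Set R) =
      PrimeSpectrum.zeroLocus (powIdeal xs n : Set R) := by
  induction xs with
  | nil => rfl
  | cons x xs ih =>
    rw [powIdeal_cons, ofList_cons_eq_sup, PrimeSpectrum.zeroLocus_sup,
      PrimeSpectrum.zeroLocus_sup, ih, PrimeSpectrum.zeroLocus_span, PrimeSpectrum.zeroLocus_span,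
      zeroLocus_pow_singleton x hn]

lemma IsParameterList.pow {xs : List R} (h : IsParameterList xs) {n : ℕ} (hn : n ≠ 0) :
    IsParameterList (xs.map (· ^ n)) := by
  intro ys y zs hys
  obtain ⟨ys', zs', rfl, rfl, hzs⟩ := List.map_eq_append_iff.1 hys
  obtain ⟨y', zs'', rfl, rfl, rfl⟩ := List.map_eq_cons_iff.1 hzs
  exact (h ys' y' zs'' rfl).congr (zeroLocus_powIdeal ys' hn) (zeroLocus_pow_singleton y' hn)

lemma DimDrop.isParameter [IsLocalRing R] {I : Ideal R} {y : R} (h : DimDrop I y)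
    (hI : I ≤ maximalIdeal R) (hy : y ∈ maximalIdeal R) :
    IsParameter (Ideal.Quotient.mk I y) := by
  constructor
  · intro hu
    obtain ⟨b, hb⟩ := hu.exists_right_inv
    obtain ⟨b, rfl⟩ := Ideal.Quotient.mk_surjective b
    rw [← map_mul, ← map_one (Ideal.Quotient.mk _), Ideal.Quotient.eq] at hb
    exact (Ideal.ne_top_iff_one _).1 (maximalIdeal.isMaximal R).ne_top
      (by simpa using sub_mem (Ideal.mul_mem_right b _ hy) (hI hb))
  · rw [DimDrop] at h
    rw [← h, ← ringKrullDim_eq_of_ringEquiv (DoubleQuot.quotQuotEquivQuotSup I (Ideal.span {y})),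
      Ideal.map_span, Set.image_singleton]

lemma IsParameterList.isParameterIdeal [IsLocalRing R] {xs : List R} (h : IsParameterList xs)
    (hxs : ∀ x ∈ xs, x ∈ maximalIdeal R) : IsParameterIdeal (Ideal.ofList xs) := by
  refine ⟨xs.length, fun i => xs[i], fun i => ?_, ?_⟩
  · have himage : Ideal.span ((fun i : Fin xs.length => xs[i]) '' {j | j < i}) =
        Ideal.ofList (xs.take i) := by
      congr 1
      ext r
      constructor
      · rintro ⟨j, hj, rfl⟩
        exact List.mem_take_iff_getElem.2 ⟨j, lt_min hj j.2, rfl⟩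
      · intro hr
        obtain ⟨j, hj, rfl⟩ := List.mem_take_iff_getElem.1 hr
        exact ⟨⟨j, hj.trans_le (min_le_right _ _)⟩, hj.trans_le (min_le_left _ _), rfl⟩
    have hdim := h (xs.take i) xs[i] (xs.drop (i + 1)) (by simp)
    have hle : Ideal.ofList (xs.take i) ≤ maximalIdeal R :=
      Ideal.span_le.2 fun r hr => hxs r (List.mem_of_mem_take hr)
    rw [← himage] at hdim hle
    exact hdim.isParameter hle (hxs _ (List.getElem_mem _))
  · refine congrArg Ideal.span (Set.ext fun r => ?_)
    rw [Set.mem_range]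
    exact List.mem_iff_get

variable [IsLocalRing R] [IsNoetherianRing R]

/-- The ideals (I : aⁿz) stabilize. If w = aⁿz is nonzero in R/I, take an associated prime P =
ann(bw). As y kills w, P must be m, so a kills bw. Stability then gives bw = 0, which is absurd. -/
lemma isFilterRegularOn_of_notMem_associatedPrimes {I : Ideal R} {y : R}
    (hy : ∀ P ∈ associatedPrimes R (R ⧸ I), P ≠ maximalIdeal R → y ∉ P) :
    IsFilterRegularOn (maximalIdeal R) y I := by
  intro z hz a ha
  let T : ℕ →o Ideal R :=
    { toFun n :=
        { carrier := {r | r * (a ^ n * z) ∈ I}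
          add_mem' h₁ h₂ := by simpa only [Set.mem_ofPred_eq, add_mul] using add_mem h₁ h₂
          zero_mem' := by simp
          smul_mem' c r hr := by
            simpa only [Set.mem_ofPred_eq, smul_eq_mul, mul_assoc] using I.mul_mem_left c hr }
      monotone' := monotone_nat_of_le_succ fun n r hr => by
        have : r * (a ^ (n + 1) * z) = a * (r * (a ^ n * z)) := by ring
        change r * (a ^ (n + 1) * z) ∈ I
        rw [this]
        exact I.mul_mem_left a hr }
  obtain ⟨n, hn⟩ := monotone_stabilizes_iff_noetherian.2 ‹_› T
  refine ⟨n, ?_⟩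
  by_contra hcon
  let w : R ⧸ I := Ideal.Quotient.mk I (a ^ n * z)
  have hw : w ≠ 0 := fun h => hcon (Ideal.Quotient.eq_zero_iff_mem.1 h)
  have : Nontrivial (Submodule.span R {w}) :=
    (Submodule.nontrivial_iff_ne_bot).2 (by simpa using hw)
  obtain ⟨P, hP⟩ := associatedPrimes.nonempty R (Submodule.span R {w})
  have hPI := associatedPrimes.subset_of_injective
    (Submodule.injective_subtype (Submodule.span R {w})) hP
  obtain ⟨hPprime, ⟨v, hv⟩, rfl⟩ := (isAssociatedPrime_iff).1 hP
  obtain ⟨b, rfl⟩ := Submodule.mem_span_singleton.1 hv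
  have hmem (r : R) : r ∈ Submodule.colon (⊥ : Submodule R (Submodule.span R {w}))
      {(⟨b • w, hv⟩ : Submodule.span R {w})} ↔ r * (b * (a ^ n * z)) ∈ I := by
    rw [Submodule.mem_colon_singleton, Submodule.mem_bot, Subtype.ext_iff,
      ← Ideal.Quotient.eq_zero_iff_mem]
    rfl
  have hym : maximalIdeal R = Submodule.colon (⊥ : Submodule R (Submodule.span R {w}))
      {(⟨b • w, hv⟩ : Submodule.span R {w})} := by
    by_contra hne
    refine hy _ hPI (Ne.symm hne) ((hmem y).2 ?_)
    have : y * (b * (a ^ n * z)) = b * a ^ n * (y • z) := by rw [smul_eq_mul]; ring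
    exact this ▸ I.mul_mem_left _ hz
  have hab := (hmem a).1 (hym ▸ ha)
  have hb : b ∈ T (n + 1) := by
    change b * (a ^ (n + 1) * z) ∈ I
    convert hab using 1
    ring
  rw [← hn (n + 1) (Nat.le_succ n)] at hb
  refine hPprime.ne_top ((Ideal.eq_top_iff_one _).2 ((hmem 1).2 ?_))
  rw [one_mul]
  exact hb

lemma exists_isFilterRegularOn_dimDrop {I : Ideal R} (hI : ¬ maximalIdeal R ≤ I.radical) :
    ∃ y ∈ maximalIdeal R, IsFilterRegularOn (maximalIdeal R) y I ∧ DimDrop I y := by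
  obtain ⟨y, hy, hyP⟩ : ∃ y ∈ maximalIdeal R,
      ∀ P ∈ associatedPrimes R (R ⧸ I), P ≠ maximalIdeal R → y ∉ P := by
    by_contra! hcon
    -- Prime avoidance; the two `⊥` are the indices allowed to be non-prime, an allowance that is
    -- not needed.
    obtain ⟨P, ⟨hP, hne⟩, hle⟩ := (Ideal.subset_union_prime_finite (I := maximalIdeal R)
      ((associatedPrimes.finite R (R ⧸ I)).sdiff (t := {maximalIdeal R})) (f := id) ⊥ ⊥
      fun P hP _ _ => hP.1.isPrime).1 fun y hy => by
        obtain ⟨P, hP, hne, hyP⟩ := hcon y hy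
        exact Set.mem_biUnion (x := P) ⟨hP, hne⟩ hyP
    exact hne ((maximalIdeal.isMaximal R).eq_of_le hP.isPrime.ne_top hle).symm
  refine ⟨y, hy, isFilterRegularOn_of_notMem_associatedPrimes hyP,
    dimDrop_of_notMem_minimalPrimes hy fun p hp => hyP p ?_ ?_⟩
  · apply Module.associatedPrimes.minimalPrimes_annihilator_subset_associatedPrimes R (R ⧸ I)
    rwa [Ideal.annihilator_quotient]
  -- If m were minimal over `I`, it would be the only prime containing `I`, so it would lie in the
  -- radical.
  · rintro rfl
    refine hI ?_
    rw [Ideal.radical_eq_sInf]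
    exact le_sInf fun q hq => hp.2 ⟨hq.2, hq.1⟩ (le_maximalIdeal hq.2.ne_top)

/-- Over a Noetherian local ring there are filter regular sequences of any length which either
consist of parameters or contain zero. -/
theorem exists_isFilterRegularSeq (i : ℕ) :
    ∃ xs : List R, xs.length = i ∧ (∀ x ∈ xs, x ∈ maximalIdeal R) ∧
      IsFilterRegularSeq (maximalIdeal R) R xs ∧
      (IsParameterList xs ∨ 0 ∈ xs ∧ maximalIdeal R ≤ (Ideal.ofList xs).radical) := by
  induction i with
  | zero => exact ⟨[], rfl, by simp, by simp [IsFilterRegularSeq], .inl (by simp [IsParameterList])⟩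
  | succ i ih =>
    obtain ⟨xs, hlen, hxs, hreg, hpar⟩ := ih
    have key (y : R) (hy : y ∈ maximalIdeal R)
        (hyreg : IsFilterRegularOn (maximalIdeal R) y (Ideal.ofList xs)) :
        (xs ++ [y]).length = i + 1 ∧ (∀ x ∈ xs ++ [y], x ∈ maximalIdeal R) ∧
          IsFilterRegularSeq (maximalIdeal R) R (xs ++ [y]) := by
      refine ⟨by simp [hlen], ?_, ?_⟩
      · intro x hx
        rcases List.mem_append.1 hx with hx | hx
        · exact hxs x hx
        · rwa [List.mem_singleton.1 hx]
      · refine List.forall_eq_append_cons_concat hreg ?_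
        simpa using hyreg
    -- Once R modulo the sequence is m-torsion, every element is filter regular on it, even 0.
    by_cases hI : maximalIdeal R ≤ (Ideal.ofList xs).radical
    · obtain ⟨h1, h2, h3⟩ := key 0 (zero_mem _) fun z _ a ha => by
        obtain ⟨n, hn⟩ := hI ha
        exact ⟨n, Ideal.mul_mem_right _ _ hn⟩
      refine ⟨xs ++ [0], h1, h2, h3, .inr ⟨by simp, hI.trans (Ideal.radical_mono ?_)⟩⟩
      rw [ofList_concat_eq_sup]
      exact le_sup_left
    · obtain ⟨y, hy, hyreg, hdim⟩ := exists_isFilterRegularOn_dimDrop hI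
      obtain ⟨h1, h2, h3⟩ := key y hy hyreg
      exact ⟨xs ++ [y], h1, h2, h3, .inl (List.forall_eq_append_cons_concat
        (hpar.resolve_right fun h => hI h.2) hdim)⟩

end Parameters

/-! ### Frobenius closures and the limit -/

section Frobenius

open IsLocalRing

variable {R : Type u} [CommRing R] (p : ℕ) [Fact p.Prime] [CharP R p]

lemma frobeniusPower_eq_map (e : ℕ) (I : Ideal R) :
    frobeniusPower p e I = I.map (iterateFrobenius R p e) :=
  rfl

lemma frobeniusPower_frobeniusPower (e e' : ℕ) (I : Ideal R) :
    frobeniusPower p e' (frobeniusPower p e I) = frobeniusPower p (e + e') I := by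
  simp only [frobeniusPower_eq_map, Ideal.map_map]
  congr 1
  ext x
  simp [iterateFrobenius_def, pow_add, pow_mul]

lemma frobeniusPower_ofList (e : ℕ) (xs : List R) :
    frobeniusPower p e (Ideal.ofList xs) = powIdeal xs (p ^ e) := by
  rw [frobeniusPower_eq_map, Ideal.map_ofList]
  rfl

lemma mem_frobeniusClosure_of_pow_mem {I : Ideal R} {x : R} (h : x ^ p ∈ frobeniusPower p 1 I) :
    x ∈ frobeniusClosure p I := by
  change ∀ᶠ e : ℕ in Filter.atTop, x ^ p ^ e ∈ frobeniusPower p e I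
  filter_upwards [Filter.eventually_ge_atTop 1] with e he
  obtain ⟨e, rfl⟩ := Nat.exists_eq_add_of_le he
  rw [← frobeniusPower_frobeniusPower, pow_add, pow_one, pow_mul]
  exact Ideal.mem_map_of_mem (iterateFrobenius R p e) h

/-- The scalar r acts on F_*R as r^p, so I·F_*R is I^[p] as a set. -/
lemma pow_mem_of_mem_smul_top {I : Ideal R} {z : R}
    (hz : (frobeniusToPushforward R p).hom z ∈ (I • ⊤ : Submodule R
      ((ModuleCat.restrictScalars (frobenius R p)).obj (ModuleCat.of R R)))) :
    z ^ p ∈ frobeniusPower p 1 I := by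
  let P : (ModuleCat.restrictScalars (frobenius R p)).obj (ModuleCat.of R R) → Prop :=
    fun w => (show R from w) ∈ frobeniusPower p 1 I
  refine Submodule.smul_induction_on (p := P) hz (fun r hr t _ => ?_) fun _ _ h₁ h₂ =>
    Ideal.add_mem _ h₁ h₂
  change r ^ p * (show R from t) ∈ frobeniusPower p 1 I
  have := Ideal.mem_map_of_mem (iterateFrobenius R p 1) hr
  rw [iterateFrobenius_def, pow_one] at this
  exact Ideal.mul_mem_right _ _ this

/-- The closure is finitely generated, so one bound on e serves all generators. -/
lemma eventually_frobeniusPower_frobeniusClosure_le [IsNoetherianRing R] (I : Ideal R) :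
    ∀ᶠ e : ℕ in Filter.atTop, frobeniusPower p e (frobeniusClosure p I) ≤ frobeniusPower p e I := by
  obtain ⟨S, hS⟩ := IsNoetherian.noetherian (frobeniusClosure p I)
  have h : ∀ᶠ e : ℕ in Filter.atTop, ∀ s ∈ S, s ^ p ^ e ∈ frobeniusPower p e I := by
    refine (Filter.eventually_all_finset S).2 fun s hs => ?_
    have : s ∈ frobeniusClosure p I := hS ▸ Submodule.subset_span hs
    exact this
  filter_upwards [h] with e he
  rw [← hS, frobeniusPower_eq_map, Ideal.submodule_span_eq, Ideal.map_span, Ideal.span_le]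
  rintro _ ⟨s, hs, rfl⟩
  exact he s hs

variable [IsLocalRing R]

/-- Induction on e, applying the hypothesis to the ideal of p^e-th powers, which is again a
parameter ideal. -/
lemma frobeniusClosure_powIdeal
    (h : ∀ q : Ideal R, IsParameterIdeal q →
      frobeniusPower p 1 (frobeniusClosure p q) = frobeniusClosure p (frobeniusPower p 1 q))
    {xs : List R} (hxs : ∀ x ∈ xs, x ∈ maximalIdeal R) (hpar : IsParameterList xs) (e : ℕ) :
    frobeniusClosure p (powIdeal xs (p ^ e)) =
      frobeniusPower p e (frobeniusClosure p (Ideal.ofList xs)) := by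
  have hp : p ≠ 0 := (Fact.out : p.Prime).ne_zero
  induction e with
  | zero => simp [powIdeal, frobeniusPower]
  | succ e ih =>
    have hq : IsParameterIdeal (powIdeal xs (p ^ e)) := by
      refine (hpar.pow (pow_ne_zero e hp)).isParameterIdeal fun x hx => ?_
      obtain ⟨y, hy, rfl⟩ := List.mem_map.1 hx
      exact Ideal.pow_mem_of_mem _ (hxs y hy) _ (pow_pos (Nat.pos_of_ne_zero hp) e)
    rw [← frobeniusPower_frobeniusPower, ← ih, h _ hq, ← frobeniusPower_ofList p e,
      frobeniusPower_frobeniusPower, frobeniusPower_ofList]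

lemma limInjective_frobeniusToPushforward [IsNoetherianRing R]
    (h : ∀ q : Ideal R, IsParameterIdeal q →
      frobeniusPower p 1 (frobeniusClosure p q) = frobeniusClosure p (frobeniusPower p 1 q))
    {xs : List R} (hxs : ∀ x ∈ xs, x ∈ maximalIdeal R) (hpar : IsParameterList xs) :
    LimInjective xs (frobeniusToPushforward R p).hom := by
  intro n z hz
  obtain ⟨e, he, hne⟩ := ((eventually_frobeniusPower_frobeniusClosure_le p
    (Ideal.ofList xs)).and (Filter.eventually_ge_atTop n)).exists
  -- Here k = p^e - n, so that level n is moved exactly to a Frobenius power.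
  obtain ⟨k, hk⟩ := Nat.exists_eq_add_of_le
    (hne.trans (Nat.lt_pow_self (Fact.out : p.Prime).one_lt).le)
  refine ⟨k, ?_⟩
  have h1 := prod_pow_smul_mem k hz
  rw [← map_smul, ← hk] at h1
  have h2 := mem_frobeniusClosure_of_pow_mem p (pow_mem_of_mem_smul_top p h1)
  rw [frobeniusClosure_powIdeal p h hxs hpar] at h2
  have h3 := he h2
  rw [frobeniusPower_ofList, hk] at h3
  rwa [smul_eq_mul, Ideal.mul_top]

end Frobenius

theorem proposition3p1 (R : Type u) [CommRing R] [IsLocalRing R] [IsNoetherianRing R]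
    (p : ℕ) [Fact p.Prime] [CharP R p]
    (h : ∀ q : Ideal R, IsParameterIdeal q →
      frobeniusPower p 1 (frobeniusClosure p q) = frobeniusClosure p (frobeniusPower p 1 q)) :
    IsFInjective R p := by
  intro i
  obtain ⟨xs, rfl, hxs, hreg, hpar⟩ := exists_isFilterRegularSeq (R := R) i
  refine (cohInj_of_limInjective xs hxs hreg (frobeniusToPushforward R p) ?_).injective
  rcases hpar with hpar | ⟨h0, -⟩
  · exact limInjective_frobeniusToPushforward p h hxs hpar
  -- The product of the sequence is 0, so every class is already zero after one transition.
  · exact fun n z _ => ⟨1, by rw [List.prod_eq_zero h0, pow_one, zero_smul]; exact zero_mem _⟩
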